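/- For a unit vector $u\in\mathbb{R}^2$ and a compact set $K\subset\mathbb{R}^2$, let $\mathcal{S}_uK$ denote the Steiner symmetral of $K$ along $u$, in the variant that maps compact sets to compact sets: for each $y\in u^\perp$, if the line $\ell_y$ through $y$ parallel to $u$ meets $K$, then $\ell_y\cap\mathcal{S}_uK$ is the closed segment of $\ell_y$ centered at $y$ whose length is the one-dimensional Lebesgue measure of $\ell_y\cap K$ (the single point $y$ if this measure is zero); otherwise $\ell_y\cap\mathcal{S}_uK=\emptyset$. Let $\alpha\in\mathbb{R}$ be not a rational multiple of $\pi$, let $u_m=(\cos m\alpha,\sin m\alpha)$ for $m\ge 1$, and let $K\subset\mathbb{R}^2$ be a nonempty compact set. Then the sets $\mathcal{S}_{u_m}\cdots\mathcal{S}_{u_1}K$ are nonempty and compact, and, as $m\to\infty$, they converge both in Hausdorff distance and in symmetric difference to the closed disc $K^*$ centered at the origin that has the same area as $K$ (with $K^*=\{0\}$ if $K$ has area zero). Here convergence of compact sets $K_m$ to $K^*$ in symmetric difference means that the area of $K_m\,\triangle\,K^*$ tends to $0$. -/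

import Mathlib

open MeasureTheory Filter Topology
open scoped symmDiff

noncomputable section

/-- The intersection of `K` with the line through `x` parallel to the unit vector `u`, in the
arc-length parameter `s ↦ x + s • u` of that line. -/
def lineSection {E : Type*} [NormedAddCommGroup E] [InnerProductSpace ℝ E]
    (u : E) (K : Set E) (x : E) : Set ℝ :=
  {s : ℝ | x + s • u ∈ K}

/-- The Steiner symmetral of `K` along the unit vector `u`, in the variant that maps compact sets
to compact sets. A point `x` lies on the line parallel to `u` through the foot
`y = x - ⟪u, x⟫ • u` in the orthogonal complement of `u`, at distance `|⟪u, x⟫|` from `y`. It belongs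
to the symmetral if this line meets `K` and `x` is in the closed segment of the line that is
centered at `y` and as long as the one-dimensional measure of the intersection of the line with `K`
(the segment is the point `y` if that measure is zero). Lines that miss `K` miss the symmetral. -/
def steinerSymmetral {E : Type*} [NormedAddCommGroup E] [InnerProductSpace ℝ E]
    (u : E) (K : Set E) : Set E :=
  {x : E | (lineSection u K x).Nonempty ∧
    ENNReal.ofReal (2 * |inner ℝ u x|) ≤ volume (lineSection u K x)}

/-- The iterated symmetrals: `K` for `m = 0`, and the symmetral of `K` successively along
`u 1`, `u 2`, ..., `u m` (the symmetrization along `u 1` is carried out first) for `m ≥ 1`. -/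
def iteratedSymmetral {E : Type*} [NormedAddCommGroup E] [InnerProductSpace ℝ E]
    (u : ℕ → E) (K : Set E) : ℕ → Set E
  | 0 => K
  | m + 1 => steinerSymmetral (u (m + 1)) (iteratedSymmetral u K m)

/-- The Kronecker directions `(cos mα, sin mα)` in the Euclidean plane. -/
def kroneckerDirection (α : ℝ) (m : ℕ) : EuclideanSpace ℝ (Fin 2) :=
  !₂[Real.cos (m * α), Real.sin (m * α)]

end

/-!
The proof estimates areas directly; it needs no compactness argument in a space of sets.

Write `S u K` for the Steiner symmetral and `K m` for the iterated symmetrals. In orthonormal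
coordinates adapted to `u`, symmetrization replaces each vertical section by the centered segment of
the same length. Hence it preserves area, maps compact sets to compact sets, and lowers the second
moment `∫ |x|²`; more precisely, the area of `K ∆ S u K` is controlled by the gain in second moment
(`secondMoment_steinerSymmetral_add_le`). The second moments of the `K m` decrease, so their gains
tend to zero, and for each fixed `j` the area of `K m ∆ K (m + j)` tends to zero
(`tendsto_volume_symmDiff_iteratedSymmetral_add`). As `K (m - j)` is symmetric in the axis
orthogonal to its direction, `K m` is, up to small area, symmetric in the axes of the last `N + 1`
directions. Since `α / π` is irrational, the mirror images of a point in these axes form a fine net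
on the circle through it when `N` is large (`exists_forall_reflection_near`).

Symmetrization is compatible with thickenings: the thickening of `K m` by `δ` is contained in the
`m`-th symmetral `L m` of the thickening `L` of `K` by `δ`
(`cthickening_iteratedSymmetral_subset`). If `K m` has a point `x` outside the disc of radius `r'`,
then `L m` contains the disc of radius `δ` about `x`. By the approximate symmetries, `L m` contains,
up to small area, every disc of radius `δ / 2` centered on the circle through `x`; because `L m` is
a Steiner symmetral, the same holds for the discs centered inside that circle
(`volume_closedBall_diff_steinerSymmetral_le`), and so `L m` has at least the area of the disc of
radius `r'`, up to a small error. For small `δ` this is impossible if that area exceeds the area of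
`K`. Therefore the `K m` are eventually contained in any disc about the origin of larger area than
`K` (`eventually_iteratedSymmetral_subset_closedBall`). Since all areas agree, this yields
convergence in symmetric difference, and then convergence in Hausdorff distance.
-/

/-! ### Compact subsets of the line -/

theorem volume_centeredSegment {A : Set ℝ} (hA : volume A ≠ ⊤) :
    volume (Set.Icc (-((volume A).toReal / 2)) ((volume A).toReal / 2)) = volume A := by
  rw [Real.volume_Icc]
  ring_nf
  exact ENNReal.ofReal_toReal hA

/-- The one-dimensional Brunn–Minkowski inequality, with an interval as one of the summands: moving
the left and right end points of `A` outwards already adds two intervals of length `c`. -/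
theorem volume_add_two_mul_le_of_shift_subset {A B : Set ℝ} {c : ℝ} (hA : IsCompact A)
    (hne : A.Nonempty) (hc : 0 ≤ c) (hB : ∀ s ∈ A, ∀ τ, |τ| ≤ c → s + τ ∈ B) :
    volume A + ENNReal.ofReal (2 * c) ≤ volume B := by
  have ha := hA.sInf_mem hne
  have hb := hA.sSup_mem hne
  set a := sInf A
  set b := sSup A
  have hlb : ∀ s ∈ A, a ≤ s := fun s hs => csInf_le hA.bddBelow hs
  have hub : ∀ s ∈ A, s ≤ b := fun s hs => le_csSup hA.bddAbove hs
  have hsub : (A ∪ Set.Ico (a - c) a) ∪ Set.Ioc b (b + c) ⊆ B := by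
    rintro s ((hs | hs) | hs)
    · simpa using hB s hs 0 (by simpa using hc)
    · simpa using hB a ha (s - a) (abs_le.2 ⟨by linarith [hs.1], by linarith [hs.2]⟩)
    · simpa using hB b hb (s - b) (abs_le.2 ⟨by linarith [hs.1], by linarith [hs.2]⟩)
  refine le_trans (le_of_eq ?_) (measure_mono hsub)
  rw [measure_union _ measurableSet_Ioc, measure_union _ measurableSet_Ico, Real.volume_Ico,
    Real.volume_Ioc, add_assoc, ← ENNReal.ofReal_add (by linarith) (by linarith)]
  · congr 2; ring
  · exact Set.disjoint_left.2 fun s hs h => absurd h.2 (not_lt.2 (hlb s hs))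
  · refine Set.disjoint_left.2 fun s hs h => ?_
    rcases hs with hs | hs
    · exact absurd h.1 (not_lt.2 (hub s hs))
    · exact absurd (h.1.trans hs.2) (not_lt.2 (hub a ha))

/-- Replacing a set `A` by the centered segment of the same length lowers the second moment, and
the gain controls the measure of the symmetric difference. The error term `4 * ε ^ 3` accounts for
the points at distance less than `ε` from the end points of the segment. -/
theorem lintegral_centeredSegment_add_le {A : Set ℝ} (hA : MeasurableSet A) (hfin : volume A ≠ ⊤)
    (y : ℝ) {ε : ℝ} (hε : 0 ≤ ε) {I : Set ℝ}
    (hI : I = Set.Icc (-((volume A).toReal / 2)) ((volume A).toReal / 2)) :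
    (∫⁻ s in I, ENNReal.ofReal (y ^ 2 + s ^ 2)) + ENNReal.ofReal (ε ^ 2) * volume (A ∆ I) ≤
      (∫⁻ s in A, ENNReal.ofReal (y ^ 2 + s ^ 2)) + ENNReal.ofReal (4 * ε ^ 3) := by
  have hvol : volume I = volume A := by rw [hI, volume_centeredSegment hfin]
  have hIm : MeasurableSet I := by rw [hI]; exact measurableSet_Icc
  set l := (volume A).toReal / 2
  have hl0 : 0 ≤ l := by positivity
  -- Away from `N`, the squares of `s` and `l` differ by at least `ε ^ 2`.
  set N : Set ℝ := Set.Icc (-l - ε) (-l + ε) ∪ Set.Icc (l - ε) (l + ε)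
  have hNm : MeasurableSet N := measurableSet_Icc.union measurableSet_Icc
  have hNvol : volume N ≤ ENNReal.ofReal (4 * ε) := by
    refine (measure_union_le _ _).trans ?_
    rw [Real.volume_Icc, Real.volume_Icc, ← ENNReal.ofReal_add (by linarith) (by linarith)]
    exact ENNReal.ofReal_le_ofReal (by linarith)
  set g : ℝ → ENNReal := fun s => ENNReal.ofReal (y ^ 2 + s ^ 2)
  have hgm : Measurable g := by fun_prop
  have hmemI : ∀ s, s ∈ I ↔ |s| ≤ l := fun s => by rw [hI, Set.mem_Icc, abs_le]
  have hmemN : ∀ s, s ∉ N → ε ^ 2 ≤ |s ^ 2 - l ^ 2| := by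
    intro s hs
    have hs' : ε ≤ |(|s| - l)| := by
      by_contra! hlt
      apply hs
      rw [abs_lt] at hlt
      rcases le_total 0 s with h | h
      · rw [abs_of_nonneg h] at hlt
        exact Or.inr ⟨by linarith, by linarith⟩
      · rw [abs_of_nonpos h] at hlt
        exact Or.inl ⟨by linarith, by linarith⟩
    have h1 : s ^ 2 - l ^ 2 = (|s| - l) * (|s| + l) := by rw [← sq_abs s]; ring
    have h2 : |(|s| - l)| ≤ |s| + l := abs_le.2 ⟨by linarith [abs_nonneg s], by linarith⟩
    rw [h1, abs_mul, abs_of_nonneg (by positivity : 0 ≤ |s| + l), sq]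
    exact mul_le_mul hs' (hs'.trans h2) hε (abs_nonneg _)
  set e := ENNReal.ofReal (ε ^ 2)
  set c := ENNReal.ofReal (y ^ 2 + l ^ 2)
  have hdiff : volume (A \ I) = volume (I \ A) :=
    measure_sdiff_symm hA.nullMeasurableSet hIm.nullMeasurableSet hvol.symm
      (ne_top_of_le_ne_top hfin (measure_mono Set.inter_subset_left))
  have hmain : ∀ D : Set ℝ, ∫⁻ s in D, Nᶜ.indicator (fun _ => e) s = e * volume (D \ N) := by
    intro D
    rw [lintegral_indicator hNm.compl, setLIntegral_const, Measure.restrict_apply hNm.compl,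
      Set.inter_comm, Set.sdiff_eq]
  have hout : c * volume (A \ I) + e * volume ((A \ I) \ N) ≤ ∫⁻ s in A \ I, g s := by
    rw [← hmain, ← setLIntegral_const, ← lintegral_add_left measurable_const]
    refine setLIntegral_mono hgm fun s hs => ?_
    have hs1 : l ^ 2 ≤ s ^ 2 := by
      have := hs.2
      rw [hmemI, not_le] at this
      rw [← sq_abs s]; gcongr
    by_cases hsN : s ∈ N
    · rw [Set.indicator_of_notMem (by simpa using hsN), add_zero]
      exact ENNReal.ofReal_le_ofReal (by linarith)
    · rw [Set.indicator_of_mem (by simpa using hsN), ← ENNReal.ofReal_add (by positivity)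
        (by positivity)]
      have := hmemN s hsN
      rw [abs_of_nonneg (by linarith)] at this
      exact ENNReal.ofReal_le_ofReal (by linarith)
  have hin : (∫⁻ s in I \ A, g s) + e * volume ((I \ A) \ N) ≤ c * volume (I \ A) := by
    rw [← hmain, ← setLIntegral_const, ← lintegral_add_left hgm]
    refine setLIntegral_mono measurable_const fun s hs => ?_
    have hs1 : s ^ 2 ≤ l ^ 2 := by
      have := hs.1
      rw [hmemI] at this
      rw [← sq_abs s]; gcongr
    by_cases hsN : s ∈ N
    · rw [Set.indicator_of_notMem (by simpa using hsN), add_zero]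
      exact ENNReal.ofReal_le_ofReal (by linarith)
    · rw [Set.indicator_of_mem (by simpa using hsN), ← ENNReal.ofReal_add (by positivity)
        (by positivity)]
      have := hmemN s hsN
      rw [abs_of_nonpos (by linarith)] at this
      exact ENNReal.ofReal_le_ofReal (by linarith)
  have hsymm : volume (A ∆ I) ≤
      volume ((A \ I) \ N) + volume ((I \ A) \ N) + ENNReal.ofReal (4 * ε) := by
    have hsub : A ∆ I ⊆ ((A \ I) \ N) ∪ ((I \ A) \ N) ∪ N := by
      intro s hs
      by_cases hsN : s ∈ N
      · exact Or.inr hsN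
      · exact Or.inl (hs.imp (fun h => ⟨h, hsN⟩) fun h => ⟨h, hsN⟩)
    exact (measure_mono hsub).trans ((measure_union_le _ _).trans
      (add_le_add (measure_union_le _ _) hNvol))
  have herr : e * ENNReal.ofReal (4 * ε) = ENNReal.ofReal (4 * ε ^ 3) := by
    rw [← ENNReal.ofReal_mul (by positivity)]; congr 1; ring
  calc (∫⁻ s in I, g s) + e * volume (A ∆ I)
      ≤ ((∫⁻ s in I ∩ A, g s) + ∫⁻ s in I \ A, g s) + e * (volume ((A \ I) \ N) +
          volume ((I \ A) \ N) + ENNReal.ofReal (4 * ε)) := by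
        rw [lintegral_inter_add_sdiff g I hA]; gcongr
    _ = (∫⁻ s in A ∩ I, g s) + e * volume ((A \ I) \ N) + ((∫⁻ s in I \ A, g s) +
          e * volume ((I \ A) \ N)) + e * ENNReal.ofReal (4 * ε) := by
        rw [Set.inter_comm]; ring
    _ ≤ (∫⁻ s in A ∩ I, g s) + e * volume ((A \ I) \ N) + c * volume (A \ I) +
          ENNReal.ofReal (4 * ε ^ 3) := by
        rw [hdiff, herr]; gcongr
    _ ≤ (∫⁻ s in A ∩ I, g s) + (∫⁻ s in A \ I, g s) + ENNReal.ofReal (4 * ε ^ 3) := by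
        rw [add_assoc (∫⁻ s in A ∩ I, g s), add_comm (e * _)]; gcongr
    _ = (∫⁻ s in A, g s) + ENNReal.ofReal (4 * ε ^ 3) := by
        rw [lintegral_inter_add_sdiff g A hIm]

/-! ### Symmetrization along the second coordinate axis -/

/-- The Steiner symmetral of a subset of `ℝ × ℝ` along the second coordinate axis, in the same
variant as `steinerSymmetral`. -/
def verticalSymmetral (k : Set (ℝ × ℝ)) : Set (ℝ × ℝ) :=
  {p | (Prod.mk p.1 ⁻¹' k).Nonempty ∧
    ENNReal.ofReal (2 * |p.2|) ≤ volume (Prod.mk p.1 ⁻¹' k)}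

theorem isCompact_prodMk_preimage {k : Set (ℝ × ℝ)} (hk : IsCompact k) (y : ℝ) :
    IsCompact (Prod.mk y ⁻¹' k) := by
  refine (hk.image continuous_snd).of_isClosed_subset (hk.isClosed.preimage (by fun_prop)) ?_
  exact fun s hs => ⟨(y, s), hs, rfl⟩

theorem prodMk_preimage_verticalSymmetral_of_nonempty {k : Set (ℝ × ℝ)} (hk : IsCompact k) {y : ℝ}
    (hy : (Prod.mk y ⁻¹' k).Nonempty) :
    Prod.mk y ⁻¹' verticalSymmetral k = Set.Icc (-((volume (Prod.mk y ⁻¹' k)).toReal / 2))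
      ((volume (Prod.mk y ⁻¹' k)).toReal / 2) := by
  ext s
  have hfin : volume (Prod.mk y ⁻¹' k) ≠ ⊤ := (isCompact_prodMk_preimage hk y).measure_ne_top
  simp only [verticalSymmetral, Set.mem_preimage, Set.mem_ofPred_eq, hy, true_and]
  rw [ENNReal.ofReal_le_iff_le_toReal hfin, Set.mem_Icc, ← abs_le]
  constructor <;> intro h <;> linarith

theorem prodMk_preimage_verticalSymmetral_of_not_nonempty {k : Set (ℝ × ℝ)} {y : ℝ}
    (hy : ¬ (Prod.mk y ⁻¹' k).Nonempty) : Prod.mk y ⁻¹' verticalSymmetral k = ∅ :=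
  Set.eq_empty_of_forall_notMem fun _ h => hy h.1

/-- The lengths of the vertical sections of a compact set are upper semicontinuous, so that the
symmetral is closed. -/
theorem isCompact_verticalSymmetral {k : Set (ℝ × ℝ)} (hk : IsCompact k) :
    IsCompact (verticalSymmetral k) := by
  have hbdd : Bornology.IsBounded (verticalSymmetral k) := by
    obtain ⟨R, hR⟩ := hk.isBounded.exists_norm_le
    refine (Metric.isBounded_Icc (-R) R |>.prod (Metric.isBounded_Icc (-R) R)).subset ?_
    rintro ⟨y, s⟩ ⟨⟨t, ht⟩, hs⟩
    have hvol : volume (Prod.mk y ⁻¹' k) ≤ volume (Set.Icc (-R) R) := by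
      refine measure_mono fun t ht => ?_
      exact abs_le.1 ((norm_snd_le (y, t)).trans (hR _ ht))
    have hs' := hs.trans hvol
    have hR0 : 0 ≤ R := (norm_nonneg _).trans (hR _ ht)
    rw [Real.volume_Icc, ENNReal.ofReal_le_ofReal_iff (by linarith)] at hs'
    exact ⟨abs_le.1 ((norm_fst_le (y, t)).trans (hR _ ht)),
      abs_le.1 (by simp only at hs'; linarith)⟩
  refine Metric.isCompact_of_isClosed_isBounded ?_ hbdd
  have hsection : ∀ F : Set (ℝ × ℝ), IsClosed F → F ⊆ k →
      IsOpen {y : ℝ | ¬ (Prod.mk y ⁻¹' F).Nonempty} := by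
    intro F hF hFk
    have : {y : ℝ | ¬ (Prod.mk y ⁻¹' F).Nonempty} = (Prod.fst '' F)ᶜ := by
      ext y
      simp [Set.Nonempty]
    rw [this]
    exact ((hk.of_isClosed_subset hF hFk).image continuous_fst).isClosed.isOpen_compl
  rw [← isOpen_compl_iff, isOpen_iff_mem_nhds]
  rintro ⟨y, s⟩ hp
  by_cases hy : (Prod.mk y ⁻¹' k).Nonempty
  · have hlt : volume (Prod.mk y ⁻¹' k) < ENNReal.ofReal (2 * |s|) := by
      by_contra! hle
      exact hp ⟨hy, hle⟩
    obtain ⟨U, hU, hUo, hUlt⟩ := (Prod.mk y ⁻¹' k).exists_isOpen_lt_of_lt _ hlt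
    have h1 := hsection (k ∩ Prod.snd ⁻¹' Uᶜ)
      (hk.isClosed.inter (hUo.isClosed_compl.preimage continuous_snd)) Set.inter_subset_left
    have h2 : IsOpen {t : ℝ | volume U < ENNReal.ofReal (2 * |t|)} :=
      isOpen_lt continuous_const (ENNReal.continuous_ofReal.comp (by fun_prop))
    filter_upwards [prod_mem_nhds (h1.mem_nhds (x := y) fun ⟨t, ht⟩ => ht.2 (hU ht.1))
      (h2.mem_nhds hUlt)] with p hp' hmem
    refine absurd (hmem.2.trans (measure_mono fun t ht => ?_)) (not_le.2 hp'.2)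
    by_contra htU
    exact hp'.1 ⟨t, ht, htU⟩
  · filter_upwards [prod_mem_nhds ((hsection k hk.isClosed le_rfl).mem_nhds hy)
      (Filter.univ_mem (f := 𝓝 s))] with p hp' hmem
    exact hp'.1 hmem.1

theorem volume_verticalSymmetral {k : Set (ℝ × ℝ)} (hk : IsCompact k) :
    volume (verticalSymmetral k) = volume k := by
  rw [Measure.volume_eq_prod, Measure.prod_apply (isCompact_verticalSymmetral hk).measurableSet,
    Measure.prod_apply hk.measurableSet]
  refine lintegral_congr fun y => ?_
  by_cases hy : (Prod.mk y ⁻¹' k).Nonempty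
  · rw [prodMk_preimage_verticalSymmetral_of_nonempty hk hy,
      volume_centeredSegment (isCompact_prodMk_preimage hk y).measure_ne_top]
  · rw [prodMk_preimage_verticalSymmetral_of_not_nonempty hy, Set.not_nonempty_iff_eq_empty.1 hy]

theorem setLIntegral_eq_lintegral_prodMk_preimage {S : Set (ℝ × ℝ)} (hS : MeasurableSet S)
    {g : ℝ × ℝ → ENNReal} (hg : Measurable g) :
    ∫⁻ p in S, g p = ∫⁻ y, ∫⁻ s in Prod.mk y ⁻¹' S, g (y, s) := by
  rw [← lintegral_indicator hS, Measure.volume_eq_prod,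
    lintegral_prod _ (hg.indicator hS).aemeasurable]
  refine lintegral_congr fun y => ?_
  rw [← lintegral_indicator (measurable_prodMk_left hS)]
  rfl

/-- Vertical symmetrization lowers the second moment, and the gain controls the area of the
symmetric difference: `lintegral_centeredSegment_add_le`, integrated over the vertical sections. -/
theorem lintegral_verticalSymmetral_add_le {k : Set (ℝ × ℝ)} (hk : IsCompact k) {R : ℝ}
    (hR : ∀ p ∈ k, |p.1| ≤ R) {ε : ℝ} (hε : 0 ≤ ε) :
    (∫⁻ p in verticalSymmetral k, ENNReal.ofReal (p.1 ^ 2 + p.2 ^ 2)) +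
        ENNReal.ofReal (ε ^ 2) * volume (k ∆ verticalSymmetral k) ≤
      (∫⁻ p in k, ENNReal.ofReal (p.1 ^ 2 + p.2 ^ 2)) +
        ENNReal.ofReal (4 * ε ^ 3) * ENNReal.ofReal (2 * R) := by
  have hkm := hk.measurableSet
  have hSm := (isCompact_verticalSymmetral hk).measurableSet
  have hg : Measurable fun p : ℝ × ℝ => ENNReal.ofReal (p.1 ^ 2 + p.2 ^ 2) := by fun_prop
  have hvol : volume (Set.Icc (-R) R) = ENNReal.ofReal (2 * R) := by
    rw [Real.volume_Icc]; ring_nf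
  have hmeas : ∀ S : Set (ℝ × ℝ), MeasurableSet S → Measurable fun y : ℝ =>
      ∫⁻ s in Prod.mk y ⁻¹' S, ENNReal.ofReal (y ^ 2 + s ^ 2) := by
    intro S hS
    have := (hg.indicator hS).lintegral_prod_right' (ν := volume)
    convert! this using 2 with y
    rw [← lintegral_indicator (measurable_prodMk_left hS)]
    rfl
  rw [setLIntegral_eq_lintegral_prodMk_preimage hSm hg,
    setLIntegral_eq_lintegral_prodMk_preimage hkm hg, Measure.volume_eq_prod,
    Measure.prod_apply (hkm.symmDiff hSm),
    ← lintegral_const_mul _ (measurable_measure_prodMk_left (hkm.symmDiff hSm)), ← hvol,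
    ← lintegral_indicator_const measurableSet_Icc, ← lintegral_add_left (hmeas _ hSm),
    ← lintegral_add_left (hmeas _ hkm)]
  refine lintegral_mono fun y => ?_
  simp only [Set.preimage_symmDiff]
  by_cases hy : (Prod.mk y ⁻¹' k).Nonempty
  · have hyR : y ∈ Set.Icc (-R) R := by
      obtain ⟨s, hs⟩ := hy
      exact abs_le.1 (hR _ hs)
    rw [Set.indicator_of_mem hyR]
    exact lintegral_centeredSegment_add_le (isCompact_prodMk_preimage hk y).measurableSet
      (isCompact_prodMk_preimage hk y).measure_ne_top y hε
      (prodMk_preimage_verticalSymmetral_of_nonempty hk hy)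
  · rw [prodMk_preimage_verticalSymmetral_of_not_nonempty hy, Set.not_nonempty_iff_eq_empty.1 hy]
    simp

/-! ### Steiner symmetrization in an inner product space -/

section InnerProductSpace

variable {E : Type*} [NormedAddCommGroup E] [InnerProductSpace ℝ E]

theorem lineSection_add_smul (u : E) (K : Set E) (x : E) (t : ℝ) :
    lineSection u K (x + t • u) = (fun s => t + s) ⁻¹' lineSection u K x := by
  ext s
  simp only [lineSection, Set.mem_ofPred_eq, Set.mem_preimage, add_smul, add_assoc]

theorem volume_lineSection_add_smul (u : E) (K : Set E) (x : E) (t : ℝ) :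
    volume (lineSection u K (x + t • u)) = volume (lineSection u K x) := by
  rw [lineSection_add_smul, measure_preimage_add]

theorem nonempty_lineSection_add_smul {u : E} {K : Set E} {x : E} {t : ℝ} :
    (lineSection u K (x + t • u)).Nonempty ↔ (lineSection u K x).Nonempty := by
  rw [lineSection_add_smul]
  exact ⟨fun ⟨s, hs⟩ => ⟨_, hs⟩, fun ⟨s, hs⟩ => ⟨s - t, by simpa using hs⟩⟩

theorem isCompact_lineSection {u : E} (hu : ‖u‖ = 1) {K : Set E} (hK : IsCompact K) (x : E) :
    IsCompact (lineSection u K x) := by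
  have hiso : Isometry fun s : ℝ => x + s • u :=
    Isometry.of_dist_eq fun s t => by
      rw [dist_add_left, dist_eq_norm, ← sub_smul, norm_smul, hu, mul_one, Real.dist_eq,
        Real.norm_eq_abs]
  exact hiso.isClosedEmbedding.isCompact_preimage hK

theorem steinerSymmetral_mono (u : E) {K L : Set E} (h : K ⊆ L) :
    steinerSymmetral u K ⊆ steinerSymmetral u L := fun x hx =>
  have hsub : lineSection u K x ⊆ lineSection u L x := fun _ hs => h hs
  ⟨hx.1.mono hsub, hx.2.trans (measure_mono hsub)⟩

theorem steinerSymmetral_nonempty (u : E) {K : Set E} (hK : K.Nonempty) (hu : ‖u‖ = 1) :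
    (steinerSymmetral u K).Nonempty := by
  obtain ⟨x, hx⟩ := hK
  refine ⟨x + (-inner ℝ u x) • u, ?_, ?_⟩
  · exact nonempty_lineSection_add_smul.2 ⟨0, by simpa [lineSection] using hx⟩
  · simp [inner_add_right, inner_smul_right, hu]

/-- A Steiner symmetral contains, with a point, all points of the line that are not farther from
its hyperplane of symmetry. -/
theorem add_smul_mem_steinerSymmetral {u : E} {K : Set E} {x : E} {t : ℝ}
    (hx : x ∈ steinerSymmetral u K) (h : |inner ℝ u (x + t • u)| ≤ |inner ℝ u x|) :
    x + t • u ∈ steinerSymmetral u K := by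
  refine ⟨nonempty_lineSection_add_smul.2 hx.1, ?_⟩
  rw [volume_lineSection_add_smul]
  exact (ENNReal.ofReal_le_ofReal (by linarith)).trans hx.2

theorem reflection_orthogonal_singleton_apply {u : E} (hu : ‖u‖ = 1) (x : E) :
    (ℝ ∙ u)ᗮ.reflection x = x + (-(2 * inner ℝ u x)) • u := by
  rw [Submodule.reflection_orthogonal_apply, Submodule.reflection_singleton_apply, hu]
  simp only [one_pow, div_one, RCLike.ofReal_real_eq_id, id, neg_sub, neg_smul, mul_smul]
  rw [← sub_eq_add_neg, two_smul ℝ, two_smul ℕ]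

theorem reflection_mem_steinerSymmetral {u : E} (hu : ‖u‖ = 1) {K : Set E} {x : E}
    (hx : x ∈ steinerSymmetral u K) : (ℝ ∙ u)ᗮ.reflection x ∈ steinerSymmetral u K := by
  rw [reflection_orthogonal_singleton_apply hu]
  refine add_smul_mem_steinerSymmetral hx (le_of_eq ?_)
  rw [inner_add_right, inner_smul_right, real_inner_self_eq_norm_sq, hu, ← abs_neg]
  ring_nf

theorem norm_add_smul_sq {u : E} (hu : ‖u‖ = 1) (x : E) (s : ℝ) :
    ‖x + s • u‖ ^ 2 = ‖x‖ ^ 2 - inner ℝ u x ^ 2 + (inner ℝ u x + s) ^ 2 := by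
  rw [norm_add_sq_real, norm_smul, hu, inner_smul_right, real_inner_comm, mul_one,
    Real.norm_eq_abs, sq_abs]
  ring

theorem steinerSymmetral_subset_closedBall {u : E} (hu : ‖u‖ = 1) {K : Set E} {R : ℝ}
    (hK : K ⊆ Metric.closedBall 0 R) : steinerSymmetral u K ⊆ Metric.closedBall 0 R := by
  rintro x ⟨⟨s₀, hs₀⟩, hx⟩
  have hR : ∀ s ∈ lineSection u K x,
      (inner ℝ u x + s) ^ 2 ≤ R ^ 2 - (‖x‖ ^ 2 - inner ℝ u x ^ 2) := by
    intro s hs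
    have := mem_closedBall_zero_iff.1 (hK hs)
    have := pow_le_pow_left₀ (norm_nonneg _) this 2
    rw [norm_add_smul_sq hu] at this
    linarith
  have hR0 : 0 ≤ R := (norm_nonneg _).trans (mem_closedBall_zero_iff.1 (hK hs₀))
  set c := inner ℝ u x
  set q := √(R ^ 2 - (‖x‖ ^ 2 - c ^ 2))
  have hq0 : 0 ≤ q := Real.sqrt_nonneg _
  have hsub : lineSection u K x ⊆ Set.Icc (-c - q) (-c + q) := by
    intro s hs
    have := abs_le.1 (Real.abs_le_sqrt (hR s hs))
    exact ⟨by linarith [this.1], by linarith [this.2]⟩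
  have hle := hx.trans (measure_mono hsub)
  rw [Real.volume_Icc, ENNReal.ofReal_le_ofReal_iff (by linarith)] at hle
  have hcq : |c| ≤ q := by linarith
  have := pow_le_pow_left₀ (abs_nonneg _) hcq 2
  rw [sq_abs, Real.sq_sqrt ((sq_nonneg _).trans (hR s₀ hs₀))] at this
  rw [mem_closedBall_zero_iff]
  exact (pow_le_pow_iff_left₀ (norm_nonneg _) hR0 two_ne_zero).1 (by linarith)

/-- The thickening of a symmetral is contained in the symmetral of the thickening: a displacement
with component `c` along `u` costs at most `2 * |c|` of length, and the thickening of a section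
gains at least as much by `volume_add_two_mul_le_of_shift_subset`. -/
theorem cthickening_steinerSymmetral_subset [FiniteDimensional ℝ E] {u : E} (hu : ‖u‖ = 1)
    {K : Set E} (hK : IsCompact K) (hSK : IsCompact (steinerSymmetral u K)) {δ : ℝ} (hδ : 0 ≤ δ) :
    Metric.cthickening δ (steinerSymmetral u K) ⊆
      steinerSymmetral u (Metric.cthickening δ K) := by
  intro x hx
  rw [hSK.cthickening_eq_biUnion_closedBall hδ] at hx
  simp only [Set.mem_iUnion, exists_prop, Metric.mem_closedBall, dist_eq_norm] at hx
  obtain ⟨z, ⟨hzne, hz⟩, hxz⟩ := hx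
  set h := x - z with hh
  have hxh : x = z + h := by rw [hh]; abel
  set c := inner ℝ u h
  have hnorm : ∀ τ, |c + τ| ≤ |c| → ‖h + τ • u‖ ≤ δ := by
    intro τ hτ
    refine le_trans ((pow_le_pow_iff_left₀ (norm_nonneg _) (norm_nonneg _) two_ne_zero).1 ?_) hxz
    rw [norm_add_smul_sq hu]
    have := sq_le_sq.2 hτ
    linarith
  have hshift : ∀ s ∈ lineSection u K z, ∀ τ, |τ| ≤ |c| →
      s + τ ∈ lineSection u (Metric.cthickening δ K) (x + (-c) • u) := by
    intro s hs τ hτ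
    refine Metric.mem_cthickening_of_dist_le _ (z + s • u) δ _ hs ?_
    rw [dist_eq_norm]
    have : x + -c • u + (s + τ) • u - (z + s • u) = h + (τ - c) • u := by rw [hxh]; module
    rw [this]
    exact hnorm _ (by simpa using hτ)
  refine ⟨?_, ?_⟩
  · obtain ⟨s, hs⟩ := hzne
    exact nonempty_lineSection_add_smul.1 ⟨_, hshift s hs 0 (by simp)⟩
  · rw [← volume_lineSection_add_smul u _ x (-c)]
    refine le_trans ?_ (volume_add_two_mul_le_of_shift_subset (isCompact_lineSection hu hK z) hzne
      (abs_nonneg c) hshift)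
    refine le_trans ?_ (add_le_add_left hz _)
    rw [← ENNReal.ofReal_add (by positivity) (by positivity), hxh, inner_add_right]
    exact ENNReal.ofReal_le_ofReal (by linarith [abs_add_le (inner ℝ u z) (inner ℝ u h)])

end InnerProductSpace

/-! ### Steiner symmetrization in the plane -/

/-- The Euclidean plane. -/
abbrev Plane := EuclideanSpace ℝ (Fin 2)

/-- Area-preserving orthonormal coordinates of the plane, with `u` as the second basis vector. -/
theorem exists_orthonormal_coordinates {u : Plane} (hu : ‖u‖ = 1) :
    ∃ e : Plane ≃ₜ ℝ × ℝ, MeasurePreserving e ∧ (∀ x, (e x).2 = inner ℝ u x) ∧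
      (∀ x, (e x).1 ^ 2 + (e x).2 ^ 2 = ‖x‖ ^ 2) ∧
      ∀ x (s : ℝ), e (x + s • u) = ((e x).1, (e x).2 + s) := by
  obtain ⟨b, hb⟩ := Orthonormal.exists_orthonormalBasis_extension_of_card_eq (𝕜 := ℝ)
    (E := Plane) (ι := Fin 2) (by simp) (v := fun _ => u) (s := {1})
    ⟨fun i => hu, fun i j hij => absurd (Subsingleton.elim i j) hij⟩
  have hb1 : b 1 = u := hb 1 rfl
  let e₁ : Plane ≃ₜ Plane := b.repr.toHomeomorph
  let e₂ : Plane ≃ₜ (Fin 2 → ℝ) := (PiLp.continuousLinearEquiv 2 ℝ _).toHomeomorph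
  let e₃ : (Fin 2 → ℝ) ≃ₜ ℝ × ℝ := Homeomorph.finTwoArrow
  have h1 : ∀ x, (((e₁.trans e₂).trans e₃) x).1 = inner ℝ (b 0) x := fun x =>
    b.repr_apply_apply x 0
  have h2 : ∀ x, (((e₁.trans e₂).trans e₃) x).2 = inner ℝ u x := fun x =>
    (b.repr_apply_apply x 1).trans (by rw [hb1])
  refine ⟨(e₁.trans e₂).trans e₃, ?_, h2, ?_, ?_⟩
  · exact (volume_preserving_finTwoArrow ℝ).comp
      ((PiLp.volume_preserving_ofLp (Fin 2)).comp b.measurePreserving_repr)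
  · intro x
    rw [h1, h2, ← b.sum_sq_norm_inner_right x, Fin.sum_univ_two, hb1]
    simp
  · intro x s
    refine Prod.ext ?_ ?_
    · rw [h1, h1, inner_add_right, inner_smul_right, ← hb1, b.inner_eq_zero (by decide)]
      simp
    · rw [h2, h2, inner_add_right, inner_smul_right, real_inner_self_eq_norm_sq, hu]
      simp

theorem steinerSymmetral_eq_preimage {u : Plane} {e : Plane ≃ₜ ℝ × ℝ}
    (he : ∀ x, (e x).2 = inner ℝ u x)
    (heu : ∀ x (s : ℝ), e (x + s • u) = ((e x).1, (e x).2 + s)) (K : Set Plane) :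
    steinerSymmetral u K = e ⁻¹' verticalSymmetral (e.symm ⁻¹' K) := by
  ext x
  have hsec : lineSection u K x =
      (fun s => (e x).2 + s) ⁻¹' (Prod.mk (e x).1 ⁻¹' (e.symm ⁻¹' K)) := by
    ext s
    simp only [lineSection, Set.mem_ofPred_eq, Set.mem_preimage]
    rw [← heu, Homeomorph.symm_apply_apply]
  have hvol := congrArg volume hsec
  rw [measure_preimage_add] at hvol
  have hne : (lineSection u K x).Nonempty ↔ (Prod.mk (e x).1 ⁻¹' (e.symm ⁻¹' K)).Nonempty := by
    rw [hsec]
    exact ⟨fun ⟨s, hs⟩ => ⟨_, hs⟩, fun ⟨s, hs⟩ => ⟨s - (e x).2, by simpa using hs⟩⟩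
  simp only [steinerSymmetral, verticalSymmetral, Set.mem_ofPred_eq, Set.mem_preimage, hvol, hne,
    he]

theorem isCompact_steinerSymmetral {u : Plane} (hu : ‖u‖ = 1) {K : Set Plane} (hK : IsCompact K) :
    IsCompact (steinerSymmetral u K) := by
  obtain ⟨e, -, he, -, heu⟩ := exists_orthonormal_coordinates hu
  rw [steinerSymmetral_eq_preimage he heu]
  exact e.isCompact_preimage.2 (isCompact_verticalSymmetral (e.symm.isCompact_preimage.2 hK))

theorem volume_steinerSymmetral {u : Plane} (hu : ‖u‖ = 1) {K : Set Plane} (hK : IsCompact K) :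
    volume (steinerSymmetral u K) = volume K := by
  obtain ⟨e, hem, he, -, heu⟩ := exists_orthonormal_coordinates hu
  have hk := e.symm.isCompact_preimage.2 hK
  rw [steinerSymmetral_eq_preimage he heu, hem.measure_preimage
    (isCompact_verticalSymmetral hk).measurableSet.nullMeasurableSet,
    volume_verticalSymmetral hk, ← hem.measure_preimage hk.measurableSet.nullMeasurableSet,
    ← Set.preimage_comp]
  simp

/-- The second moment `∫ |x|²` of a plane set about the origin. -/
noncomputable def secondMoment (K : Set Plane) : ENNReal :=
  ∫⁻ x in K, ENNReal.ofReal (‖x‖ ^ 2)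

theorem secondMoment_lt_top {K : Set Plane} (hK : IsCompact K) : secondMoment K < ⊤ := by
  obtain ⟨R, hR⟩ := hK.isBounded.exists_norm_le
  refine setLIntegral_lt_top_of_le_nnreal hK.measure_lt_top.ne ⟨(R ^ 2).toNNReal, fun x hx => ?_⟩
  exact ENNReal.ofReal_le_ofReal (pow_le_pow_left₀ (norm_nonneg _) (hR x hx) 2)

/-- Steiner symmetrization lowers the second moment, and the area of the symmetric difference of
a set and its symmetral is controlled by the gain. -/
theorem secondMoment_steinerSymmetral_add_le {u : Plane} (hu : ‖u‖ = 1) {K : Set Plane}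
    (hK : IsCompact K) {R : ℝ} (hR : K ⊆ Metric.closedBall 0 R) {ε : ℝ} (hε : 0 ≤ ε) :
    secondMoment (steinerSymmetral u K) +
        ENNReal.ofReal (ε ^ 2) * volume (K ∆ steinerSymmetral u K) ≤
      secondMoment K + ENNReal.ofReal (4 * ε ^ 3) * ENNReal.ofReal (2 * R) := by
  obtain ⟨e, hem, he, hen, heu⟩ := exists_orthonormal_coordinates hu
  have hk := e.symm.isCompact_preimage.2 hK
  have hS := steinerSymmetral_eq_preimage he heu K
  set k := e.symm ⁻¹' K with hkdef
  have hKk : K = e ⁻¹' k := by rw [hkdef, ← Set.preimage_comp]; simp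
  have hSk := isCompact_verticalSymmetral hk
  have hmom : ∀ s : Set (ℝ × ℝ), MeasurableSet s → secondMoment (e ⁻¹' s) =
      ∫⁻ p in s, ENNReal.ofReal (p.1 ^ 2 + p.2 ^ 2) := by
    intro s hs
    rw [← hem.setLIntegral_comp_preimage hs (by fun_prop)]
    simp only [hen]
    rfl
  have hbd : ∀ p ∈ k, |p.1| ≤ R := by
    intro p hp
    have hx := mem_closedBall_zero_iff.1 (hR hp)
    have hn := hen (e.symm p)
    rw [Homeomorph.apply_symm_apply] at hn
    refine (abs_le_of_sq_le_sq ?_ (norm_nonneg _)).trans hx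
    linarith [sq_nonneg p.2]
  have := lintegral_verticalSymmetral_add_le hk hbd hε
  rw [← hmom _ hSk.measurableSet, ← hmom _ hk.measurableSet, ← hem.measure_preimage
    (hk.measurableSet.symmDiff hSk.measurableSet).nullMeasurableSet, Set.preimage_symmDiff,
    ← hS, ← hKk] at this
  exact this

/-! ### Iterated symmetrals -/

section Iterated

variable {u : ℕ → Plane} {K : Set Plane}

theorem isCompact_iteratedSymmetral (hu : ∀ m, ‖u m‖ = 1) (hK : IsCompact K) (m : ℕ) :
    IsCompact (iteratedSymmetral u K m) := by
  induction m with
  | zero => exact hK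
  | succ m ih => exact isCompact_steinerSymmetral (hu _) ih

theorem iteratedSymmetral_nonempty (hu : ∀ m, ‖u m‖ = 1) (hK : K.Nonempty) (m : ℕ) :
    (iteratedSymmetral u K m).Nonempty := by
  induction m with
  | zero => exact hK
  | succ m ih => exact steinerSymmetral_nonempty _ ih (hu _)

theorem volume_iteratedSymmetral (hu : ∀ m, ‖u m‖ = 1) (hK : IsCompact K) (m : ℕ) :
    volume (iteratedSymmetral u K m) = volume K := by
  induction m with
  | zero => rfl
  | succ m ih =>
    exact (volume_steinerSymmetral (hu _) (isCompact_iteratedSymmetral hu hK m)).trans ih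

theorem iteratedSymmetral_subset_closedBall (hu : ∀ m, ‖u m‖ = 1) {R : ℝ}
    (hK : K ⊆ Metric.closedBall 0 R) (m : ℕ) :
    iteratedSymmetral u K m ⊆ Metric.closedBall 0 R := by
  induction m with
  | zero => exact hK
  | succ m ih => exact steinerSymmetral_subset_closedBall (hu _) ih

theorem cthickening_iteratedSymmetral_subset (hu : ∀ m, ‖u m‖ = 1) (hK : IsCompact K) {δ : ℝ}
    (hδ : 0 ≤ δ) (m : ℕ) : Metric.cthickening δ (iteratedSymmetral u K m) ⊆
      iteratedSymmetral u (Metric.cthickening δ K) m := by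
  induction m with
  | zero => exact le_rfl
  | succ m ih =>
    exact (cthickening_steinerSymmetral_subset (hu _) (isCompact_iteratedSymmetral hu hK m)
      (isCompact_iteratedSymmetral hu hK (m + 1)) hδ).trans (steinerSymmetral_mono _ ih)

/-- Consecutive symmetrals get close in area, for any sequence of directions: their second moments
decrease, so the gains, which control the symmetric differences, tend to zero. -/
theorem tendsto_volume_symmDiff_iteratedSymmetral_succ (hu : ∀ m, ‖u m‖ = 1) (hK : IsCompact K) :
    Tendsto (fun m => volume (iteratedSymmetral u K m ∆ iteratedSymmetral u K (m + 1)))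
      atTop (𝓝 0) := by
  have hc := isCompact_iteratedSymmetral hu hK
  obtain ⟨R, hR0, hR⟩ : ∃ R : ℝ, 0 < R ∧ K ⊆ Metric.closedBall 0 R := by
    obtain ⟨R, hR⟩ := hK.isBounded.subset_closedBall 0
    exact ⟨max R 1, by positivity, hR.trans (Metric.closedBall_subset_closedBall (le_max_left _ _))⟩
  set a : ℕ → ℝ := fun m => (secondMoment (iteratedSymmetral u K m)).toReal with ha
  set v : ℕ → ENNReal := fun m =>
    volume (iteratedSymmetral u K m ∆ iteratedSymmetral u K (m + 1)) with hv
  have hvfin : ∀ m, v m ≠ ⊤ := fun m => ne_top_of_le_ne_top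
    ((hc m).union (hc (m + 1))).measure_ne_top (measure_mono Set.symmDiff_subset_union)
  have hgain : ∀ m (ε : ℝ), 0 ≤ ε → a (m + 1) + ε ^ 2 * (v m).toReal ≤ a m + 8 * R * ε ^ 3 := by
    intro m ε hε
    have h : secondMoment (iteratedSymmetral u K (m + 1)) + ENNReal.ofReal (ε ^ 2) * v m ≤
        secondMoment (iteratedSymmetral u K m) +
          ENNReal.ofReal (4 * ε ^ 3) * ENNReal.ofReal (2 * R) :=
      secondMoment_steinerSymmetral_add_le (hu (m + 1)) (hc m)
        (iteratedSymmetral_subset_closedBall hu hR m) hε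
    have hfin := secondMoment_lt_top (hc m)
    have hfin' := secondMoment_lt_top (hc (m + 1))
    have h' := ENNReal.toReal_mono (by finiteness) h
    rw [ENNReal.toReal_add hfin'.ne (ENNReal.mul_ne_top (by finiteness) (hvfin m)),
      ENNReal.toReal_add hfin.ne (by finiteness), ENNReal.toReal_mul, ENNReal.toReal_mul,
      ENNReal.toReal_ofReal (by positivity), ENNReal.toReal_ofReal (by positivity),
      ENNReal.toReal_ofReal (by positivity)] at h'
    calc _ ≤ _ := h'
      _ = _ := by simp only [ha]; ring
  have hanti : Antitone a := antitone_nat_of_succ_le fun m => by simpa using hgain m 0 le_rfl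
  have hlim : Tendsto a atTop (𝓝 (⨅ m, a m)) :=
    tendsto_atTop_ciInf hanti ⟨0, by rintro _ ⟨m, rfl⟩; exact ENNReal.toReal_nonneg⟩
  have hdiff : Tendsto (fun m => a m - a (m + 1)) atTop (𝓝 0) := by
    simpa using hlim.sub (hlim.comp (tendsto_add_atTop_nat 1))
  rw [← ENNReal.tendsto_toReal_iff hvfin ENNReal.zero_ne_top, ENNReal.toReal_zero]
  rw [tendsto_order]
  refine ⟨fun b hb => Eventually.of_forall fun m => hb.trans_le ENNReal.toReal_nonneg,
    fun η hη => ?_⟩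
  -- With this choice the error term of the gain inequality, divided by `ε ^ 2`, equals `η / 2`.
  set ε := η / (16 * R) with hε
  have hε0 : 0 < ε := by positivity
  have hεR : 8 * R * ε = η / 2 := by rw [hε]; field_simp; norm_num
  filter_upwards [hdiff.eventually_lt_const (show 0 < ε ^ 2 * (η / 2) by positivity)] with m hm
  have h := hgain m ε hε0.le
  have h3 : 8 * R * ε ^ 3 = ε ^ 2 * (η / 2) := by rw [← hεR]; ring
  rw [h3] at h
  exact lt_of_mul_lt_mul_left (by linarith) (sq_nonneg ε)

theorem tendsto_volume_symmDiff_iteratedSymmetral_add (hu : ∀ m, ‖u m‖ = 1) (hK : IsCompact K)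
    (j : ℕ) : Tendsto (fun m => volume (iteratedSymmetral u K m ∆ iteratedSymmetral u K (m + j)))
      atTop (𝓝 0) := by
  induction j with
  | zero => simp
  | succ j ih =>
    have h := ih.add ((tendsto_volume_symmDiff_iteratedSymmetral_succ hu hK).comp
      (tendsto_add_atTop_nat j))
    rw [add_zero] at h
    exact tendsto_of_tendsto_of_tendsto_of_le_of_le tendsto_const_nhds h (fun _ => zero_le)
      fun m => measure_symmDiff_le _ _ _

end Iterated

/-! ### Transport of almost-inclusions of discs -/

/-- If `L` contains a disc and is close in area to a set with an axis of symmetry, then it almost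
contains the mirror image of the disc. -/
theorem volume_closedBall_reflection_diff_le {u : Plane} (hu : ‖u‖ = 1) {L M : Set Plane}
    (hL : IsCompact L) (hM : IsCompact M) {x : Plane} {δ : ℝ} (hx : Metric.closedBall x δ ⊆ L) :
    volume (Metric.closedBall ((ℝ ∙ u)ᗮ.reflection x) δ \ L) ≤
      2 * volume (steinerSymmetral u M ∆ L) := by
  set ρ := (ℝ ∙ u)ᗮ.reflection with hρ
  set L' := steinerSymmetral u M
  have hL'm : MeasurableSet L' := (isCompact_steinerSymmetral hu hM).measurableSet
  have hsub : Metric.closedBall (ρ x) δ \ L ⊆ (L' ∆ L) ∪ ρ ⁻¹' (L' ∆ L) := by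
    rintro p ⟨hp, hpL⟩
    have hq : ρ p ∈ L := by
      apply hx
      rwa [Metric.mem_closedBall, ← ρ.dist_map, Submodule.reflection_reflection]
    by_cases hq' : ρ p ∈ L'
    · refine Or.inl (Or.inl ⟨?_, hpL⟩)
      have := reflection_mem_steinerSymmetral hu hq'
      rwa [← hρ, Submodule.reflection_reflection] at this
    · exact Or.inr (Or.inr ⟨hq, hq'⟩)
  refine (measure_mono hsub).trans ((measure_union_le _ _).trans (le_of_eq ?_))
  rw [ρ.measurePreserving.measure_preimage
    (hL'm.symmDiff hL.measurableSet).nullMeasurableSet, two_mul]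

/-- If a Steiner symmetral `L` almost contains all discs of radius `η` with centers on a circle
about the origin, then it almost contains those with centers inside the circle: either half of such
a disc moves along `u` away from the axis of symmetry to a disc centered on the circle, and points
outside `L` stay outside. -/
theorem volume_closedBall_diff_steinerSymmetral_le {u : Plane} (hu : ‖u‖ = 1) {M : Set Plane}
    {a η : ℝ} {c : ENNReal} (h : ∀ w : Plane, ‖w‖ = a →
      volume (Metric.closedBall w η \ steinerSymmetral u M) ≤ c)
    {z : Plane} (hz : ‖z‖ ≤ a) :
    volume (Metric.closedBall z η \ steinerSymmetral u M) ≤ 2 * c := by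
  have ha0 : 0 ≤ a := (norm_nonneg _).trans hz
  set b := inner ℝ u z with hb
  set q := √(b ^ 2 + (a ^ 2 - ‖z‖ ^ 2))
  have hrad : 0 ≤ a ^ 2 - ‖z‖ ^ 2 := by
    have := pow_le_pow_left₀ (norm_nonneg _) hz 2
    linarith
  have hq2 : q ^ 2 = b ^ 2 + (a ^ 2 - ‖z‖ ^ 2) := Real.sq_sqrt (by positivity)
  have hbq : |b| ≤ q := Real.abs_le_sqrt (by linarith)
  have hcirc : ∀ s : ℝ, (b + s) ^ 2 = q ^ 2 → ‖z + s • u‖ = a := by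
    intro s hs
    have := norm_add_smul_sq hu z s
    rw [← hb, hs, hq2] at this
    exact (pow_left_inj₀ (norm_nonneg _) ha0 two_ne_zero).1 (by linarith)
  have hshift : ∀ s : ℝ, ‖z + s • u‖ = a →
      volume ((fun p => p + s • u) ⁻¹'
        (Metric.closedBall (z + s • u) η \ steinerSymmetral u M)) ≤ c := by
    intro s hs
    rw [measure_preimage_add_right]
    exact h _ hs
  have houter : ∀ p ∉ steinerSymmetral u M, ∀ s : ℝ, |inner ℝ u p| ≤ |inner ℝ u p + s| →
      p + s • u ∉ steinerSymmetral u M := by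
    intro p hp s hs hmem
    have heq : p + s • u + (-s) • u = p := by module
    refine hp (heq ▸ add_smul_mem_steinerSymmetral (t := -s) hmem ?_)
    rw [heq, inner_add_right, inner_smul_right, real_inner_self_eq_norm_sq, hu]
    simpa using hs
  have hsub : Metric.closedBall z η \ steinerSymmetral u M ⊆
      ((fun p => p + (q - b) • u) ⁻¹'
        (Metric.closedBall (z + (q - b) • u) η \ steinerSymmetral u M)) ∪
      ((fun p => p + (-q - b) • u) ⁻¹'
        (Metric.closedBall (z + (-q - b) • u) η \ steinerSymmetral u M)) := by
    rintro p ⟨hp, hpL⟩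
    have hqb := abs_le.1 hbq
    rcases le_total 0 (inner ℝ u p) with hpos | hneg
    · refine Or.inl ⟨?_, houter p hpL _ ?_⟩
      · rwa [Metric.mem_closedBall, dist_add_right]
      · exact abs_le_abs_of_nonneg hpos (by linarith)
    · refine Or.inr ⟨?_, houter p hpL _ ?_⟩
      · rwa [Metric.mem_closedBall, dist_add_right]
      · exact abs_le_abs_of_nonpos hneg (by linarith)
  refine (measure_mono hsub).trans ((measure_union_le _ _).trans ?_)
  rw [two_mul]
  exact add_le_add (hshift _ (hcirc _ (by ring))) (hshift _ (hcirc _ (by ring)))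

/-! ### The mirror images of a point in the axes of the Kronecker directions -/

theorem exists_forall_multiple_near {α : ℝ} (hα : Irrational (α / Real.pi)) {ε : ℝ} (hε : 0 < ε) :
    ∃ N : ℕ, ∀ β : ℝ, ∃ j ≤ N, ∃ k : ℤ, |β - j * (2 * α) - k * (2 * Real.pi)| ≤ ε := by
  have : Fact (0 < 2 * Real.pi) := ⟨Real.two_pi_pos⟩
  have hd : DenseRange (· • ((2 * α : ℝ) : AddCircle (2 * Real.pi)) :
      ℤ → AddCircle (2 * Real.pi)) := by
    rw [AddCircle.denseRange_zsmul_coe_iff, mul_div_mul_left _ _ two_ne_zero]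
    exact hα
  obtain ⟨t, ht⟩ := isCompact_univ.elim_finite_subcover
    (fun n : ℤ => Metric.ball (n • ((2 * α : ℝ) : AddCircle (2 * Real.pi))) ε)
    (fun _ => Metric.isOpen_ball) fun x _ => by
      obtain ⟨n, hn⟩ := hd.exists_dist_lt x hε
      exact Set.mem_iUnion.2 ⟨n, hn⟩
  -- The multiples that are used may be negative; shifting the target by `n₀` makes them natural.
  set n₀ := t.sup Int.natAbs
  refine ⟨2 * n₀, fun β => ?_⟩
  obtain ⟨n, hnt, hn⟩ := Set.mem_iUnion₂.1
    (ht (Set.mem_univ ((β - n₀ * (2 * α) : ℝ) : AddCircle (2 * Real.pi))))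
  have hle : n.natAbs ≤ n₀ := Finset.le_sup (f := Int.natAbs) hnt
  refine ⟨(n + n₀).toNat, by omega, round ((2 * Real.pi)⁻¹ *
    (β - n₀ * (2 * α) - n • (2 * α))), ?_⟩
  rw [Metric.mem_ball, dist_eq_norm, ← AddCircle.coe_zsmul, ← AddCircle.coe_sub,
    AddCircle.norm_eq] at hn
  have hcast : (((n + n₀).toNat : ℕ) : ℝ) = n + n₀ := by
    have : (((n + n₀).toNat : ℕ) : ℤ) = n + n₀ := Int.toNat_of_nonneg (by omega)
    exact_mod_cast this
  rw [hcast]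
  refine le_of_eq_of_le (congrArg _ ?_) hn.le
  rw [zsmul_eq_mul]
  ring

/-- The point of the plane with polar coordinates `r` and `t`. -/
noncomputable def polarPoint (r t : ℝ) : Plane := !₂[r * Real.cos t, r * Real.sin t]

theorem exists_eq_polarPoint (x : Plane) : ∃ t, x = polarPoint ‖x‖ t := by
  set z : ℂ := ⟨x 0, x 1⟩ with hz
  have hn : ‖x‖ = ‖z‖ := by
    rw [EuclideanSpace.norm_eq, Complex.norm_eq_sqrt_sq_add_sq, Fin.sum_univ_two]
    simp [hz]
  refine ⟨z.arg, ?_⟩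
  ext i
  fin_cases i
  · simp [polarPoint, hn, hz]
  · simp [polarPoint, hn, hz]

theorem dist_polarPoint_le (r s t : ℝ) :
    dist (polarPoint r s) (polarPoint r t) ≤ |r| * |s - t| := by
  refine (pow_le_pow_iff_left₀ dist_nonneg (by positivity) two_ne_zero).1 ?_
  rw [EuclideanSpace.dist_eq, Real.sq_sqrt (by positivity), Fin.sum_univ_two, mul_pow, sq_abs,
    sq_abs, Real.dist_eq, Real.dist_eq, sq_abs, sq_abs]
  have h := Real.one_sub_sq_div_two_le_cos (x := s - t)
  rw [Real.cos_sub] at h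
  have h1 : (r * Real.cos s - r * Real.cos t) ^ 2 + (r * Real.sin s - r * Real.sin t) ^ 2 =
      r ^ 2 * (2 - 2 * (Real.cos s * Real.cos t + Real.sin s * Real.sin t)) := by
    linear_combination r ^ 2 * Real.sin_sq_add_cos_sq s + r ^ 2 * Real.sin_sq_add_cos_sq t
  simp only [polarPoint, PiLp.toLp_apply, Matrix.cons_val_zero, Matrix.cons_val_one]
  rw [h1]
  exact mul_le_mul_of_nonneg_left (by linarith) (sq_nonneg r)

theorem polarPoint_add_int_mul_two_pi (r t : ℝ) (k : ℤ) :
    polarPoint r (t + k * (2 * Real.pi)) = polarPoint r t := by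
  simp only [polarPoint, Real.cos_add_int_mul_two_pi, Real.sin_add_int_mul_two_pi]

theorem norm_kroneckerDirection (α : ℝ) (m : ℕ) : ‖kroneckerDirection α m‖ = 1 := by
  rw [EuclideanSpace.norm_eq, Fin.sum_univ_two]
  simp [kroneckerDirection]

theorem reflection_kroneckerDirection_polarPoint (α r t : ℝ) (m : ℕ) :
    (ℝ ∙ kroneckerDirection α m)ᗮ.reflection (polarPoint r t) =
      polarPoint r (2 * (m * α) + Real.pi - t) := by
  rw [reflection_orthogonal_singleton_apply (norm_kroneckerDirection α m)]
  obtain ⟨b, rfl⟩ : ∃ b, t = m * α - b := ⟨m * α - t, by ring⟩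
  have hin : inner ℝ (kroneckerDirection α m) (polarPoint r (m * α - b)) = r * Real.cos b := by
    have hb : Real.cos b = Real.cos (m * α - (m * α - b)) := by ring_nf
    rw [PiLp.inner_apply, Fin.sum_univ_two, hb, Real.cos_sub]
    simp [kroneckerDirection, polarPoint]
    ring
  rw [hin, show 2 * (m * α) + Real.pi - (m * α - b) = (m * α + b) + Real.pi by ring]
  ext i
  fin_cases i
  · simp [polarPoint, kroneckerDirection, Real.cos_add, Real.cos_sub]
    ring
  · simp [polarPoint, kroneckerDirection, Real.sin_add, Real.sin_sub]
    ring

/-- The mirror images of a point in finitely many consecutive axes form a net on the circle through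
it; the number of axes depends only on the fineness and on a bound for the radius. -/
theorem exists_forall_reflection_near {α : ℝ} (hα : Irrational (α / Real.pi)) {ε : ℝ} (hε : 0 < ε)
    (R : ℝ) : ∃ N : ℕ, ∀ m ≥ N, ∀ x w : Plane, ‖x‖ ≤ R → ‖w‖ = ‖x‖ →
      ∃ j ≤ N, dist w ((ℝ ∙ kroneckerDirection α (m - j))ᗮ.reflection x) ≤ ε := by
  have hR : 0 < max R 1 := by positivity
  obtain ⟨N, hN⟩ := exists_forall_multiple_near hα (div_pos hε hR)
  refine ⟨N, fun m hm x w hx hw => ?_⟩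
  obtain ⟨t, ht⟩ := exists_eq_polarPoint x
  obtain ⟨s, hs⟩ := exists_eq_polarPoint w
  obtain ⟨j, hj, k, hk⟩ := hN (2 * (m * α) + Real.pi - t - s)
  refine ⟨j, hj, ?_⟩
  have h1 : (ℝ ∙ kroneckerDirection α (m - j))ᗮ.reflection x =
      polarPoint ‖x‖ (2 * ((m - j : ℕ) * α) + Real.pi - t) := by
    conv_lhs => rw [ht]
    exact reflection_kroneckerDirection_polarPoint _ _ _ _
  rw [h1, hs, hw, ← polarPoint_add_int_mul_two_pi _ s k]
  refine (dist_polarPoint_le _ _ _).trans ?_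
  rw [abs_norm, Nat.cast_sub (hj.trans hm), abs_sub_comm]
  calc ‖x‖ * |2 * ((m - j : ℝ) * α) + Real.pi - t - (s + k * (2 * Real.pi))|
      ≤ max R 1 * (ε / max R 1) := by
        refine mul_le_mul (hx.trans (le_max_left _ _)) (le_of_eq_of_le (congrArg _ ?_) hk)
          (abs_nonneg _) hR.le
        ring
    _ = ε := by field_simp

/-! ### Convergence -/

/-- Eventually the symmetrals lie in any given disc about the origin whose area exceeds that
of `K`. Otherwise the symmetrals of a thickening of `K` would contain small discs with centers
outside the given disc, hence almost contain all discs of half the radius with centers in it, hence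
almost contain the given disc, which has larger area. -/
theorem eventually_iteratedSymmetral_subset_closedBall {α : ℝ} (hα : Irrational (α / Real.pi))
    {K : Set Plane} (hK : IsCompact K) {r : ℝ}
    (hr : volume K < volume (Metric.closedBall (0 : Plane) r)) :
    ∀ᶠ m in atTop, iteratedSymmetral (kroneckerDirection α) K m ⊆ Metric.closedBall 0 r := by
  have hu := norm_kroneckerDirection α
  obtain ⟨δ, hδr, hδ⟩ : ∃ δ, volume (Metric.cthickening δ K) <
      volume (Metric.closedBall (0 : Plane) r) ∧ 0 < δ :=
    ((((tendsto_measure_cthickening_of_isCompact hK).eventually_lt_const hr).filter_mono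
      nhdsWithin_le_nhds).and (self_mem_nhdsWithin (s := Set.Ioi (0 : ℝ)))).exists
  have hL := hK.cthickening (r := δ)
  set L := iteratedSymmetral (kroneckerDirection α) (Metric.cthickening δ K)
  have hLm : ∀ m, IsCompact (L m) := isCompact_iteratedSymmetral hu hL
  obtain ⟨R, hR⟩ := hL.isBounded.subset_closedBall 0
  obtain ⟨N, hN⟩ := exists_forall_reflection_near hα (half_pos hδ) R
  obtain ⟨t, ht, htfin, hcover⟩ :=
    (isCompact_closedBall (0 : Plane) r).finite_cover_balls (half_pos hδ)
  -- Each of the covering discs will be contained in the symmetral up to area `4 * c`.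
  obtain ⟨c, hc0, hc⟩ := ENNReal.exists_nnreal_pos_mul_lt
    (a := htfin.toFinset.card * 4) (by finiteness) (tsub_pos_of_lt hδr).ne'
  have hclose : ∀ᶠ i in atTop, ∀ j ∈ Finset.range (N + 1), volume (L i ∆ L (i + j)) < c :=
    (Finset.eventually_all _).2 fun j _ =>
      (tendsto_volume_symmDiff_iteratedSymmetral_add hu hL j).eventually_lt_const
        (ENNReal.coe_pos.2 hc0)
  obtain ⟨i₀, hi₀⟩ := eventually_atTop.1 hclose
  filter_upwards [eventually_ge_atTop (i₀ + N + 1)] with m hm x hx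
  rw [mem_closedBall_zero_iff]
  by_contra! hxr
  have hball : Metric.closedBall x δ ⊆ L m :=
    (Metric.closedBall_subset_cthickening hx δ).trans
      (cthickening_iteratedSymmetral_subset hu hK hδ.le m)
  have hxR : ‖x‖ ≤ R := mem_closedBall_zero_iff.1
    (iteratedSymmetral_subset_closedBall hu hR m (hball (Metric.mem_closedBall_self hδ.le)))
  have hcircle : ∀ w : Plane, ‖w‖ = ‖x‖ →
      volume (Metric.closedBall w (δ / 2) \ L m) ≤ 2 * c := by
    intro w hw
    obtain ⟨j, hj, hjw⟩ := hN m (by omega) x w hxR hw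
    obtain ⟨i, hi⟩ : ∃ i, m - j = i + 1 := ⟨m - j - 1, by omega⟩
    have h1 := volume_closedBall_reflection_diff_le (hu (m - j)) (hLm m) (hLm i) hball
    have h2 : steinerSymmetral (kroneckerDirection α (m - j)) (L i) = L (m - j) := by
      rw [hi]; rfl
    have h3 := hi₀ (m - j) (by omega) j (Finset.mem_range.2 (by omega))
    rw [Nat.sub_add_cancel (by omega)] at h3
    rw [h2] at h1
    refine le_trans (measure_mono (Set.sdiff_subset_sdiff_left ?_)) (h1.trans ?_)
    · exact Metric.closedBall_subset_closedBall' (by linarith)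
    · gcongr
  obtain ⟨i, hi⟩ : ∃ i, m = i + 1 := ⟨m - 1, by omega⟩
  have hdisc : ∀ z ∈ t, volume (Metric.closedBall z (δ / 2) \ L m) ≤ 4 * c := by
    intro z hz
    have hzr : ‖z‖ ≤ ‖x‖ := (mem_closedBall_zero_iff.1 (ht hz)).trans hxr.le
    have hLi : L m = steinerSymmetral (kroneckerDirection α m) (L i) := by
      rw [hi]; rfl
    rw [hLi] at hcircle ⊢
    refine (volume_closedBall_diff_steinerSymmetral_le (hu m) hcircle hzr).trans (le_of_eq ?_)
    rw [← mul_assoc]; norm_num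
  have hdiff : volume (Metric.closedBall 0 r \ L m) <
      volume (Metric.closedBall (0 : Plane) r) - volume (Metric.cthickening δ K) := by
    have hsub : Metric.closedBall 0 r \ L m ⊆
        ⋃ z ∈ htfin.toFinset, Metric.closedBall z (δ / 2) \ L m := by
      rintro p ⟨hp, hpL⟩
      obtain ⟨z, hz, hpz⟩ := Set.mem_iUnion₂.1 (hcover hp)
      exact Set.mem_iUnion₂.2 ⟨z, htfin.mem_toFinset.2 hz, Metric.ball_subset_closedBall hpz, hpL⟩
    refine lt_of_le_of_lt ((measure_mono hsub).trans ((measure_biUnion_finset_le _ _).trans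
      (Finset.sum_le_card_nsmul _ _ (4 * (c : ENNReal)) fun z hz =>
        hdisc z (htfin.mem_toFinset.1 hz)))) ?_
    rwa [nsmul_eq_mul, ← mul_assoc, mul_comm]
  have hle : volume (Metric.closedBall (0 : Plane) r) ≤
      volume (Metric.closedBall 0 r \ L m) + volume (Metric.cthickening δ K) := by
    rw [← volume_iteratedSymmetral hu hL m]
    refine (measure_mono fun p hp => ?_).trans (measure_union_le _ _)
    by_cases h : p ∈ L m
    exacts [Or.inr h, Or.inl ⟨hp, h⟩]
  exact absurd hle (not_le.2 (lt_tsub_iff_right.1 hdiff))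

theorem volume_closedBall_lt_volume_closedBall {r s : ℝ} (hr : 0 ≤ r) (h : r < s) :
    volume (Metric.closedBall (0 : Plane) r) < volume (Metric.closedBall (0 : Plane) s) := by
  rw [EuclideanSpace.volume_closedBall_fin_two, EuclideanSpace.volume_closedBall_fin_two,
    ← ENNReal.ofReal_pow hr, ← ENNReal.ofReal_pow (hr.trans h.le),
    ← ENNReal.ofReal_mul (by positivity), ← ENNReal.ofReal_mul (by positivity)]
  refine ENNReal.ofReal_lt_ofReal_iff'.2 ⟨?_, ?_⟩
  · have := Real.pi_pos
    gcongr
  · have := hr.trans_lt h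
    have := Real.pi_pos
    positivity

theorem exists_volume_closedBall_eq {K : Set Plane} (hK : volume K ≠ ⊤) :
    ∃ r : ℝ, 0 ≤ r ∧ volume (Metric.closedBall (0 : Plane) r) = volume K := by
  refine ⟨√((volume K).toReal / Real.pi), Real.sqrt_nonneg _, ?_⟩
  rw [EuclideanSpace.volume_closedBall_fin_two, ← ENNReal.ofReal_pow (Real.sqrt_nonneg _),
    Real.sq_sqrt (by positivity), ← ENNReal.ofReal_mul (by positivity),
    div_mul_cancel₀ _ Real.pi_ne_zero, ENNReal.ofReal_toReal hK]

/-- Since the areas agree, convergence in symmetric difference follows from the eventual inclusion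
in all larger concentric discs. -/
theorem tendsto_volume_symmDiff_closedBall {A : ℕ → Set Plane} {r : ℝ}
    (hA : ∀ m, MeasurableSet (A m))
    (hvol : ∀ m, volume (A m) = volume (Metric.closedBall (0 : Plane) r))
    (hsub : ∀ η > 0, ∀ᶠ m in atTop, A m ⊆ Metric.closedBall 0 (r + η)) :
    Tendsto (fun m => volume (A m ∆ Metric.closedBall 0 r)) atTop (𝓝 0) := by
  set D := Metric.closedBall (0 : Plane) r with hD
  have hDm : MeasurableSet D := Metric.isClosed_closedBall.measurableSet
  have hDfin : volume D ≠ ⊤ := (isCompact_closedBall _ _).measure_ne_top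
  have heq : ∀ m, volume (A m ∆ D) = 2 * volume (A m \ D) := by
    intro m
    rw [measure_symmDiff_eq (hA m).nullMeasurableSet hDm.nullMeasurableSet, two_mul,
      measure_sdiff_symm hDm.nullMeasurableSet (hA m).nullMeasurableSet (hvol m).symm
        (ne_top_of_le_ne_top hDfin (measure_mono Set.inter_subset_left))]
  simp only [heq]
  rw [ENNReal.tendsto_nhds_zero]
  intro ε hε
  -- The areas of the discs of radius `r + η` tend to that of `D` as `η` decreases to `0`.
  have hcont : Tendsto (fun η : ℝ => volume (Metric.closedBall (0 : Plane) (r + η)))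
      (𝓝 0) (𝓝 (volume D)) := by
    have h : Continuous fun η : ℝ => volume (Metric.closedBall (0 : Plane) (r + η)) := by
      simp only [EuclideanSpace.volume_closedBall_fin_two]
      refine ENNReal.continuous_mul_const ENNReal.ofReal_ne_top |>.comp
        ((ENNReal.continuous_pow 2).comp (ENNReal.continuous_ofReal.comp (by fun_prop)))
    simpa [hD] using h.tendsto 0
  have hlt : volume D < volume D + ε / 2 :=
    ENNReal.lt_add_right hDfin (ENNReal.half_pos hε.ne').ne'
  obtain ⟨η, hη, hη0⟩ := (((hcont.eventually_lt_const hlt).filter_mono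
    nhdsWithin_le_nhds).and (self_mem_nhdsWithin (s := Set.Ioi (0 : ℝ)))).exists
  filter_upwards [hsub η hη0] with m hm
  have hle : volume (A m \ D) ≤ ε / 2 := by
    refine (measure_mono (Set.sdiff_subset_sdiff_left hm)).trans ?_
    rw [measure_sdiff (Metric.closedBall_subset_closedBall (by linarith))
      hDm.nullMeasurableSet hDfin]
    exact tsub_le_iff_left.2 hη.le
  calc 2 * volume (A m \ D) ≤ 2 * (ε / 2) := by gcongr
    _ = ε := ENNReal.mul_div_cancel two_ne_zero ENNReal.ofNat_ne_top

/-- Convergence in symmetric difference to a disc, together with eventual inclusion in all larger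
concentric discs, implies convergence in Hausdorff distance: a point of the disc at distance more
than `ε` from `A m` is close to a disc of fixed size that misses `A m`. -/
theorem tendsto_hausdorffDist_closedBall {A : ℕ → Set Plane} {r : ℝ} (hr : 0 ≤ r)
    (hne : ∀ m, (A m).Nonempty)
    (hsub : ∀ η > 0, ∀ᶠ m in atTop, A m ⊆ Metric.closedBall 0 (r + η))
    (hsymm : Tendsto (fun m => volume (A m ∆ Metric.closedBall 0 r)) atTop (𝓝 0)) :
    Tendsto (fun m => Metric.hausdorffDist (A m) (Metric.closedBall 0 r)) atTop (𝓝 0) := by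
  rw [Metric.tendsto_nhds]
  intro ε hε
  have hnear : ∀ᶠ m in atTop, ∀ x ∈ Metric.closedBall (0 : Plane) r,
      ∃ y ∈ A m, dist x y ≤ ε / 2 := by
    rcases hr.eq_or_lt with rfl | hr
    · filter_upwards [hsub (ε / 2) (half_pos hε)] with m hm x hx
      obtain ⟨y, hy⟩ := hne m
      rw [Metric.closedBall_zero, Set.mem_singleton_iff] at hx
      refine ⟨y, hy, ?_⟩
      rw [hx, dist_comm]
      simpa using hm hy
    · set κ := min (ε / 2) r / 2 with hκ
      have hκ0 : 0 < κ := by positivity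
      have hκε : κ + κ ≤ ε / 2 := by
        rw [hκ, add_halves]; exact min_le_left _ _
      have hκr : κ ≤ r := by
        have := min_le_right (ε / 2) r
        linarith
      have hpos : 0 < volume (Metric.closedBall (0 : Plane) κ) :=
        Metric.measure_closedBall_pos _ _ hκ0
      filter_upwards [hsymm.eventually_lt_const hpos] with m hm x hx
      by_contra! hfar
      obtain ⟨z, hxz, hz⟩ := exists_dist_le_le (δ := κ) (ε := r - κ) (x := x) (z := 0)
        hκ0.le (by linarith) (by simpa using hx)
      refine absurd hm (not_lt.2 ?_)
      rw [← Measure.addHaar_closedBall_center volume z κ]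
      refine measure_mono fun p hp => Or.inr ⟨?_, fun hpA => ?_⟩
      · exact Metric.closedBall_subset_closedBall' (by linarith) hp
      · have := hfar p hpA
        have := dist_triangle x z p
        rw [Metric.mem_closedBall, dist_comm] at hp
        linarith
  filter_upwards [hnear, hsub (ε / 2) (half_pos hε)] with m h1 h2
  rw [dist_zero_right, Real.norm_of_nonneg Metric.hausdorffDist_nonneg]
  refine lt_of_le_of_lt (Metric.hausdorffDist_le_of_mem_dist (half_pos hε).le (fun x hx => ?_) h1)
    (half_lt_self hε)
  obtain ⟨y, hxy, hy⟩ := exists_dist_le_le (x := x) (z := 0) (half_pos hε).le hr (h2 hx)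
  exact ⟨y, hy, hxy⟩

theorem theorem5p1 (α : ℝ) (hα : Irrational (α / Real.pi))
    (K : Set (EuclideanSpace ℝ (Fin 2))) (hK : IsCompact K) (hne : K.Nonempty) :
    (∀ m : ℕ, IsCompact (iteratedSymmetral (kroneckerDirection α) K m) ∧
      (iteratedSymmetral (kroneckerDirection α) K m).Nonempty) ∧
    ∃ r : ℝ, 0 ≤ r ∧
      volume (Metric.closedBall (0 : EuclideanSpace ℝ (Fin 2)) r) = volume K ∧
      Tendsto (fun m : ℕ => Metric.hausdorffDist
        (iteratedSymmetral (kroneckerDirection α) K m)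
        (Metric.closedBall (0 : EuclideanSpace ℝ (Fin 2)) r)) atTop (𝓝 0) ∧
      Tendsto (fun m : ℕ => volume
        (iteratedSymmetral (kroneckerDirection α) K m ∆
          Metric.closedBall (0 : EuclideanSpace ℝ (Fin 2)) r)) atTop (𝓝 0) := by
  have hu := norm_kroneckerDirection α
  have hc := isCompact_iteratedSymmetral hu hK
  have hn := iteratedSymmetral_nonempty hu hne
  obtain ⟨r, hr, hvol⟩ := exists_volume_closedBall_eq hK.measure_ne_top
  have hsub : ∀ η > 0, ∀ᶠ m in atTop,
      iteratedSymmetral (kroneckerDirection α) K m ⊆ Metric.closedBall 0 (r + η) := fun η hη =>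
    eventually_iteratedSymmetral_subset_closedBall hα hK
      (hvol ▸ volume_closedBall_lt_volume_closedBall hr (lt_add_of_pos_right r hη))
  have hsymm := tendsto_volume_symmDiff_closedBall (fun m => (hc m).measurableSet)
    (fun m => (volume_iteratedSymmetral hu hK m).trans hvol.symm) hsub
  exact ⟨fun m => ⟨hc m, hn m⟩, r, hr, hvol, tendsto_hausdorffDist_closedBall hr hn hsub hsymm,
    hsymm⟩
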